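/- Let $\mu$ be a probability measure on $\mathbb{R}^D$ (the law of a random vector $X$) with support $\operatorname{supp}(X)$, let $y:\mathbb{R}^D\to\mathbb{R}$ be measurable, and let $X^{(1)},\dots,X^{(L)}$ be independent random vectors with law $\mu$, with observations $Y^{(l)}=y(X^{(l)})$. Let $\eta=(\eta_1,\dots,\eta_K)^\top$ ($K\ge 1$) be a vector of bounded measurable functions $\eta_k:\mathbb{R}^D\to\mathbb{R}$. Let $R=\big(E[\eta_k(X)\eta_\kappa(X)]\big)_{k,\kappa=1,\dots,K}$ and assume that $0<\lambda_*\le\lambda_{\min}(R)\le\lambda_{\max}(R)\le\lambda^*<\infty$. Put $$m:=\sup_{x\in\operatorname{supp}(X)}\sum_{k=1}^K|\eta_k(x)|^2,\qquad \tau:=(1-\epsilon)\lambda_*\quad\text{for some }\epsilon\in(0,1).$$ The estimator $\hat y_L$ is constructed as follows. Let $A=(\eta_k(X^{(l)}))_{l=1,\dots,L;\,k=1,\dots,K}$, and take any singular value decomposition $A^\top=\mathcal U\mathcal D\mathcal V$ with $\mathcal U\in O(K)$, $\mathcal V\in O(L)$, where $\mathcal D$ is the $K\times L$ matrix with the singular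 values $s_1\ge\dots\ge s_K\ge0$ of $A$ on the diagonal and zero entries otherwise (with $s_k:=0$ for $k>L$, in case $L<K$). If $s_K^2\ge L\tau$, let $\alpha_L=\mathcal U\mathcal D^\dagger\mathcal V\,(Y^{(1)},\dots,Y^{(L)})^\top$, where $\mathcal D^\dagger$ is the $K\times L$ matrix with $s_1^{-1},\dots,s_K^{-1}$ on the diagonal and zero entries otherwise; if $s_K^2<L\tau$, let $\alpha_L=0$. Finally let $\hat y_L(x)=\alpha_L^\top\eta(x)$. Then $\int_{\mathbb{R}^D}|y(x)-\hat y_L(x)|^2\,\mu(dx)$ is (almost everywhere equal to) a $[0,\infty]$-valued random variable, and $$E\left[\int_{\mathbb{R}^D}|y(x)-\hat y_L(x)|^2\,\mu(dx)\right]\le\left(1+\frac{\lambda^*}{\lambda_*(1-\epsilon)}\right)\inf_{\alpha\in\mathbb{R}^K}\int_{\mathbb{R}^D}|y(x)-\alpha^\top\eta(x)|^2\,\mu(dx)$$ $$\qquad+\;2K\exp\left\{-\frac{3\epsilon^2L}{6m\lambda^*/\lambda_*^2+2\epsilon\,(m/\lambda_*+\lambda^*/\lambda_*)}\right\}\int_{\mathbb{R}^D}|y(x)|^2\,\mu(dx),$$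 where all integrals take values in $[0,\infty]$. -/

import Mathlib

open MeasureTheory ProbabilityTheory
open scoped Matrix ENNReal

noncomputable section

/-- The empirical regression matrix `A = (η_k(x_l))`, with rows indexed by the sample points `x_l`
and columns indexed by the basis functions. -/
def regressionMatrix {D K L : ℕ} (η : Fin K → EuclideanSpace ℝ (Fin D) → ℝ)
    (x : Fin L → EuclideanSpace ℝ (Fin D)) : Matrix (Fin L) (Fin K) ℝ :=
  Matrix.of fun l k => η k (x l)

/-- The `K × L` matrix with `s` on its main diagonal and zero entries otherwise. -/
def rectDiagonal {K : ℕ} (L : ℕ) (s : Fin K → ℝ) : Matrix (Fin K) (Fin L) ℝ :=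
  Matrix.of fun k l => if (k : ℕ) = (l : ℕ) then s k else 0

/-- `Aᵀ = U 𝒟 V` is a singular value decomposition of `Aᵀ`, where `A` is an `L × K` matrix and the
diagonal of `𝒟` carries the singular values `s_1 ≥ … ≥ s_K ≥ 0` of `A` (indexed here from `0`).
If `L < K`, only the first `L` of them fit on the diagonal; the others are zero, so that in all
cases the `s_k ^ 2` are the `K` eigenvalues of `Aᵀ A`. -/
structure IsSVD {K L : ℕ} (A : Matrix (Fin L) (Fin K) ℝ) (U : Matrix (Fin K) (Fin K) ℝ)
    (s : Fin K → ℝ) (V : Matrix (Fin L) (Fin L) ℝ) : Prop where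
  left_orthogonal : U ∈ Matrix.orthogonalGroup (Fin K) ℝ
  right_orthogonal : V ∈ Matrix.orthogonalGroup (Fin L) ℝ
  antitone : Antitone s
  nonneg : ∀ k, 0 ≤ s k
  eq_zero : ∀ k : Fin K, L ≤ (k : ℕ) → s k = 0
  transpose_eq : Aᵀ = U * rectDiagonal L s * V

/-- `a` is the coefficient vector that least-squares regression with brute-force SVD truncation at
the threshold `τ` returns for the regression matrix `A` and the observations `Y`, for some singular
value decomposition of `Aᵀ`: it is `U 𝒟† V Y` if `s_K ^ 2 ≥ L τ`, and zero if `s_K ^ 2 < L τ`. -/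
def IsBruteForceSVDCoeff {K L : ℕ} (hK : 0 < K) (τ : ℝ) (A : Matrix (Fin L) (Fin K) ℝ)
    (Y : Fin L → ℝ) (a : Fin K → ℝ) : Prop :=
  ∃ (U : Matrix (Fin K) (Fin K) ℝ) (s : Fin K → ℝ) (V : Matrix (Fin L) (Fin L) ℝ),
    IsSVD A U s V ∧
      ((L : ℝ) * τ ≤ s ⟨K - 1, Nat.sub_lt hK Nat.one_pos⟩ ^ 2 →
        a = (U * rectDiagonal L (fun k => (s k)⁻¹) * V) *ᵥ Y) ∧
      (s ⟨K - 1, Nat.sub_lt hK Nat.one_pos⟩ ^ 2 < (L : ℝ) * τ → a = 0)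

/-- The Gram matrix `R = (E[η_k(X) η_κ(X)])`, where `X` has law `μ`. -/
def gramMatrix {D K : ℕ} (μ : Measure (EuclideanSpace ℝ (Fin D)))
    (η : Fin K → EuclideanSpace ℝ (Fin D) → ℝ) : Matrix (Fin K) (Fin K) ℝ :=
  Matrix.of fun k κ => ∫ x, η k x * η κ x ∂μ

/-- The smallest eigenvalue of a (nonempty, symmetric) real matrix. -/
def minEigenvalue {K : ℕ} (M : Matrix (Fin K) (Fin K) ℝ) : ℝ := sInf (spectrum ℝ M)

/-- The largest eigenvalue of a (nonempty, symmetric) real matrix. -/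
def maxEigenvalue {K : ℕ} (M : Matrix (Fin K) (Fin K) ℝ) : ℝ := sSup (spectrum ℝ M)

/-- The squared `L²(μ)`-error `∫ |y(x) - aᵀ η(x)|² μ(dx)`, as a number in `[0, ∞]`. -/
def sqError {D K : ℕ} (μ : Measure (EuclideanSpace ℝ (Fin D)))
    (η : Fin K → EuclideanSpace ℝ (Fin D) → ℝ) (y : EuclideanSpace ℝ (Fin D) → ℝ)
    (a : Fin K → ℝ) : ℝ≥0∞ :=
  ∫⁻ x, ENNReal.ofReal (|y x - ∑ k, a k * η k x| ^ 2) ∂μ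

end

/-!
On the event that `AᵀA` is bounded below by `L τ`, the coefficient vector is the ordinary
least-squares solution `(AᵀA)⁻¹AᵀY`, whichever singular value decomposition was used
(`IsBruteForceSVDCoeff.eq_truncatedLeastSquares`). Let `b` be the coefficient vector of the
`L²(μ)`-projection of `y` onto the span of the `η_k`, and `f` the residual. The normal equations
give `L τ ‖α - b‖² ≤ ∑ l, f (X l) ^ 2`, and by orthogonality the error is
`∫ f² + (α - b)ᵀ R (α - b) ≤ ∫ f² + λ^* ‖α - b‖²`. Taking expectations yields the first term of the
bound (`lintegral_sqError_sampleCoeff_le`). On the complementary event `α = 0`, and the error is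
`∫ y²`; so it remains to bound the probability of that event.

As `τ = (1 - ε) λ_*`, this is a lower tail estimate for the smallest eigenvalue of
`AᵀA = ∑ l, η(X l) η(X l)ᵀ`. It is obtained by the Laplace transform method for matrices
(`measure_not_posSemidef_sum_le`): `tr exp(-θ AᵀA)` dominates the exponential of `-θ` times the
smallest eigenvalue, and each independent summand lowers the expected trace by a factor
`exp(-λ_* (θ - θ² m / 2))`. The choice `θ = ε / m` gives the bound
`K exp(-ε² L λ_* / (2 m))`, which is smaller than the one claimed because `λ_* ≤ λ^*`.

Since the summands have rank one, the effect of a single summand is controlled without the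
Golden–Thompson or Lieb inequalities, by
`tr exp(M - v vᵀ) ≤ tr exp M - (1 - ‖v‖² / 2) vᵀ exp(M) v` (`trace_exp_sub_vecMulVec_le`).
After a shift of `M` by a multiple of the identity, this inequality holds for each power in the
exponential series, where it follows by replacing the factors `M - v vᵀ` by `M` one at a time.
-/

/-! ### Traces of exponentials under rank-one perturbations -/

section RankOne

variable {n : Type*} [Fintype n] [DecidableEq n]

/-- The moments `vᵀ N ^ k v` are those of the spectral measure of `N` at `v`: in an orthonormal
eigenbasis of `N`, the weights `w` are the squared coordinates of `v`, and `ν` are the eigenvalues. -/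
lemma exists_quadForm_pow_eq_sum {N : Matrix n n ℝ} (hN : N.PosSemidef) (v : n → ℝ) :
    ∃ w ν : n → ℝ, (∀ i, 0 ≤ w i) ∧ (∀ i, 0 ≤ ν i) ∧
      ∀ k : ℕ, v ⬝ᵥ (N ^ k) *ᵥ v = ∑ i, w i * ν i ^ k := by
  set U : Matrix n n ℝ := (hN.isHermitian.eigenvectorUnitary : Matrix n n ℝ) with hU
  refine ⟨fun i => (Uᵀ *ᵥ v) i ^ 2, hN.isHermitian.eigenvalues, fun i => sq_nonneg _,
    hN.eigenvalues_nonneg, fun k => ?_⟩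
  have h : N ^ k = U * Matrix.diagonal (fun i => hN.isHermitian.eigenvalues i ^ k) * Uᵀ := by
    conv_lhs => rw [hN.isHermitian.spectral_theorem]
    rw [← map_pow, Matrix.diagonal_pow, Unitary.conjStarAlgAut_apply]
    rfl
  rw [h, ← Matrix.mulVec_mulVec, ← Matrix.mulVec_mulVec, Matrix.dotProduct_mulVec,
    ← Matrix.mulVec_transpose]
  simp only [dotProduct, Matrix.mulVec_diagonal]
  exact Finset.sum_congr rfl fun i _ => by ring

lemma quadForm_pow_nonneg {N : Matrix n n ℝ} (hN : N.PosSemidef) (v : n → ℝ) (k : ℕ) :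
    0 ≤ v ⬝ᵥ (N ^ k) *ᵥ v :=
  (hN.pow k).dotProduct_mulVec_nonneg v

/-- Chebyshev's association inequality for the spectral measure of `N` at `v`. -/
lemma quadForm_pow_mul_le {N : Matrix n n ℝ} (hN : N.PosSemidef) (v : n → ℝ) (a b : ℕ) :
    (v ⬝ᵥ (N ^ a) *ᵥ v) * (v ⬝ᵥ (N ^ b) *ᵥ v) ≤ (v ⬝ᵥ v) * (v ⬝ᵥ (N ^ (a + b)) *ᵥ v) := by
  obtain ⟨w, ν, hw, hν, h⟩ := exists_quadForm_pow_eq_sum hN v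
  have h0 : v ⬝ᵥ v = ∑ i, w i := by simpa using h 0
  -- Expand the nonnegative double sum: the two factors of each term have the same sign.
  have key : 0 ≤ ∑ i, ∑ j, w i * w j * ((ν i ^ a - ν j ^ a) * (ν i ^ b - ν j ^ b)) := by
    refine Finset.sum_nonneg fun i _ => Finset.sum_nonneg fun j _ =>
      mul_nonneg (mul_nonneg (hw i) (hw j)) ?_
    rcases le_total (ν i) (ν j) with hij | hij
    · exact mul_nonneg_of_nonpos_of_nonpos
        (sub_nonpos.2 (pow_le_pow_left₀ (hν i) hij a)) (sub_nonpos.2 (pow_le_pow_left₀ (hν i) hij b))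
    · exact mul_nonneg
        (sub_nonneg.2 (pow_le_pow_left₀ (hν j) hij a)) (sub_nonneg.2 (pow_le_pow_left₀ (hν j) hij b))
  have e : ∑ i, ∑ j, w i * w j * ((ν i ^ a - ν j ^ a) * (ν i ^ b - ν j ^ b)) =
      2 * ((v ⬝ᵥ v) * (v ⬝ᵥ (N ^ (a + b)) *ᵥ v)) -
        2 * ((v ⬝ᵥ (N ^ a) *ᵥ v) * (v ⬝ᵥ (N ^ b) *ᵥ v)) := by
    have e1 : ∀ i j, w i * w j * ((ν i ^ a - ν j ^ a) * (ν i ^ b - ν j ^ b)) =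
        (w i * ν i ^ (a + b)) * w j + w i * (w j * ν j ^ (a + b))
          - (w i * ν i ^ a) * (w j * ν j ^ b) - (w i * ν i ^ b) * (w j * ν j ^ a) := by
      intro i j; ring
    simp only [e1, Finset.sum_add_distrib, Finset.sum_sub_distrib, ← Finset.mul_sum,
      ← Finset.sum_mul, ← h, ← h0]
    ring
  linarith

omit [DecidableEq n] in
lemma quadForm_transpose (B : Matrix n n ℝ) (v : n → ℝ) : v ⬝ᵥ Bᵀ *ᵥ v = v ⬝ᵥ B *ᵥ v := by
  rw [Matrix.dotProduct_mulVec, Matrix.vecMul_transpose, dotProduct_comm]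

omit [DecidableEq n] in
lemma dotProduct_mul_vecMulVec_mul_mulVec (B C : Matrix n n ℝ) (u v : n → ℝ) :
    u ⬝ᵥ (B * Matrix.vecMulVec v v * C) *ᵥ u = (u ⬝ᵥ B *ᵥ v) * (v ⬝ᵥ C *ᵥ u) := by
  rw [Matrix.mul_vecMulVec, Matrix.vecMulVec_mul, Matrix.vecMulVec_mulVec, dotProduct_smul,
    ← Matrix.dotProduct_mulVec]
  simp

/-- Replacing one of the factors `N - v vᵀ` by `N`. -/
lemma quadForm_pow_mul_pow_succ (N : Matrix n n ℝ) (v : n → ℝ) (i j : ℕ) :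
    v ⬝ᵥ (N ^ j * (N - Matrix.vecMulVec v v) ^ (i + 1)) *ᵥ v =
      v ⬝ᵥ (N ^ (j + 1) * (N - Matrix.vecMulVec v v) ^ i) *ᵥ v -
        (v ⬝ᵥ (N ^ j) *ᵥ v) * (v ⬝ᵥ ((N - Matrix.vecMulVec v v) ^ i) *ᵥ v) := by
  have : N ^ j * (N - Matrix.vecMulVec v v) ^ (i + 1) =
      N ^ (j + 1) * (N - Matrix.vecMulVec v v) ^ i -
        N ^ j * Matrix.vecMulVec v v * (N - Matrix.vecMulVec v v) ^ i := by
    rw [pow_succ' _ i, pow_succ]; noncomm_ring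
  rw [this, Matrix.sub_mulVec, dotProduct_sub, dotProduct_mul_vecMulVec_mul_mulVec]

lemma quadForm_pow_mul_pow_le {N : Matrix n n ℝ} (hN : N.PosSemidef) (v : n → ℝ)
    (hN' : (N - Matrix.vecMulVec v v).PosSemidef) (i j : ℕ) :
    v ⬝ᵥ (N ^ j * (N - Matrix.vecMulVec v v) ^ i) *ᵥ v ≤ v ⬝ᵥ (N ^ (i + j)) *ᵥ v := by
  induction i generalizing j with
  | zero => simp
  | succ i ih =>
    rw [quadForm_pow_mul_pow_succ]
    have := ih (j + 1)
    rw [show i + 1 + j = i + (j + 1) by ring]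
    have := mul_nonneg (quadForm_pow_nonneg hN v j) (quadForm_pow_nonneg hN' v i)
    linarith

/-- First-order lower bound for a mixed product of powers of `N` and `N - v vᵀ`. For `i = 0`, the
truncated subtraction `i + j - 1` is harmless because of the factor `i`. -/
lemma le_quadForm_pow_mul_pow {N : Matrix n n ℝ} (hN : N.PosSemidef) (v : n → ℝ)
    (hN' : (N - Matrix.vecMulVec v v).PosSemidef) (i j : ℕ) :
    v ⬝ᵥ (N ^ (i + j)) *ᵥ v - i * ((v ⬝ᵥ v) * (v ⬝ᵥ (N ^ (i + j - 1)) *ᵥ v)) ≤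
      v ⬝ᵥ (N ^ j * (N - Matrix.vecMulVec v v) ^ i) *ᵥ v := by
  induction i generalizing j with
  | zero => simp
  | succ i ih =>
    rw [quadForm_pow_mul_pow_succ]
    have h1 := ih (j + 1)
    rw [show i + (j + 1) - 1 = i + j by lia] at h1
    rw [show i + 1 + j - 1 = i + j by lia, show i + 1 + j = i + (j + 1) by ring]
    have h2 := mul_le_mul_of_nonneg_left
      (by simpa using quadForm_pow_mul_pow_le hN v hN' i 0) (quadForm_pow_nonneg hN v j)
    have h3 := quadForm_pow_mul_le hN v j i
    rw [add_comm j i] at h3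
    push_cast
    linarith

/-- Second-order upper bound for the trace of a mixed product; the case `j = 0` is a Taylor expansion
of `tr (N - v vᵀ) ^ i` with a one-sided remainder. Wherever one of the natural-number subtractions
truncates, its coefficient vanishes. -/
lemma trace_pow_mul_pow_le {N : Matrix n n ℝ} (hN : N.PosSemidef) (v : n → ℝ)
    (hN' : (N - Matrix.vecMulVec v v).PosSemidef) (i j : ℕ) :
    (N ^ j * (N - Matrix.vecMulVec v v) ^ i).trace ≤
      (N ^ (i + j)).trace - i * (v ⬝ᵥ (N ^ (i + j - 1)) *ᵥ v) +
        i * (i - 1) / 2 * ((v ⬝ᵥ v) * (v ⬝ᵥ (N ^ (i + j - 2)) *ᵥ v)) := by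
  induction i generalizing j with
  | zero => simp
  | succ i ih =>
    have e : N ^ j * (N - Matrix.vecMulVec v v) ^ (i + 1) =
        N ^ (j + 1) * (N - Matrix.vecMulVec v v) ^ i -
          N ^ j * Matrix.vecMulVec v v * (N - Matrix.vecMulVec v v) ^ i := by
      rw [pow_succ' _ i, pow_succ]; noncomm_ring
    have e2 : (N ^ j * Matrix.vecMulVec v v * (N - Matrix.vecMulVec v v) ^ i).trace =
        v ⬝ᵥ (N ^ j * (N - Matrix.vecMulVec v v) ^ i) *ᵥ v := by
      have hT : ∀ {B : Matrix n n ℝ}, B.PosSemidef → Bᵀ = B := fun hB => by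
        simpa using hB.isHermitian.eq
      rw [Matrix.mul_vecMulVec, Matrix.vecMulVec_mul, Matrix.trace_vecMulVec,
        dotProduct_comm, ← Matrix.dotProduct_mulVec, Matrix.mulVec_mulVec,
        ← quadForm_transpose, Matrix.transpose_mul, Matrix.transpose_pow, Matrix.transpose_pow,
        hT hN, hT hN']
    rw [e, Matrix.trace_sub, e2]
    have h1 := ih (j + 1)
    have h2 := le_quadForm_pow_mul_pow hN v hN' i j
    rw [show i + (j + 1) - 1 = i + j by lia, show i + (j + 1) - 2 = i + j - 1 by lia] at h1
    rw [show i + 1 + j - 1 = i + j by lia, show i + 1 + j - 2 = i + j - 1 by lia,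
      show i + 1 + j = i + (j + 1) by ring]
    push_cast
    linarith

lemma hasSum_trace_exp (N : Matrix n n ℝ) :
    HasSum (fun k : ℕ => (k.factorial : ℝ)⁻¹ * (N ^ k).trace) (NormedSpace.exp N).trace := by
  have h : HasSum (fun k : ℕ => (k.factorial : ℝ)⁻¹ • N ^ k) (NormedSpace.exp N) := by
    open scoped Matrix.Norms.Operator in exact NormedSpace.exp_series_hasSum_exp' N
  have := h.map (Matrix.traceAddMonoidHom n ℝ) (continuous_id.matrix_trace)
  exact this.congr_fun fun k => by simp

lemma hasSum_quadForm_exp (N : Matrix n n ℝ) (v : n → ℝ) :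
    HasSum (fun k : ℕ => (k.factorial : ℝ)⁻¹ * (v ⬝ᵥ (N ^ k) *ᵥ v))
      (v ⬝ᵥ (NormedSpace.exp N) *ᵥ v) := by
  have h : HasSum (fun k : ℕ => (k.factorial : ℝ)⁻¹ • N ^ k) (NormedSpace.exp N) := by
    open scoped Matrix.Norms.Operator in exact NormedSpace.exp_series_hasSum_exp' N
  let φ : Matrix n n ℝ →ₗ[ℝ] ℝ :=
    { toFun := fun B => v ⬝ᵥ B *ᵥ v
      map_add' := fun B C => by rw [Matrix.add_mulVec, dotProduct_add]
      map_smul' := fun c B => by rw [Matrix.smul_mulVec, dotProduct_smul]; rfl }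
  have hφ : Continuous φ := continuous_const.dotProduct (continuous_id.matrix_mulVec continuous_const)
  refine (h.map φ hφ).congr_fun fun k => ?_
  rw [Function.comp_apply, map_smul]
  rfl

/-- The inequality `trace_exp_sub_vecMulVec_le` for positive semidefinite matrices, by summing
`trace_pow_mul_pow_le` over the exponential series. -/
lemma trace_exp_sub_vecMulVec_le_of_posSemidef {N : Matrix n n ℝ} (hN : N.PosSemidef) (v : n → ℝ)
    (hN' : (N - Matrix.vecMulVec v v).PosSemidef) :
    (NormedSpace.exp (N - Matrix.vecMulVec v v)).trace ≤
      (NormedSpace.exp N).trace - (1 - (v ⬝ᵥ v) / 2) * (v ⬝ᵥ (NormedSpace.exp N) *ᵥ v) := by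
  have h1 : HasSum (fun k : ℕ => (k.factorial : ℝ)⁻¹ * (k * (v ⬝ᵥ (N ^ (k - 1)) *ᵥ v)))
      (v ⬝ᵥ (NormedSpace.exp N) *ᵥ v) := by
    rw [← hasSum_nat_add_iff' 1]
    simp only [Finset.range_one, Finset.sum_singleton, Nat.cast_zero, zero_mul, mul_zero, sub_zero]
    refine (hasSum_quadForm_exp N v).congr_fun fun k => ?_
    rw [Nat.factorial_succ, Nat.add_sub_cancel]
    push_cast
    field_simp
  have h2 : HasSum (fun k : ℕ => (k.factorial : ℝ)⁻¹ *
      (k * (k - 1) / 2 * ((v ⬝ᵥ v) * (v ⬝ᵥ (N ^ (k - 2)) *ᵥ v))))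
      ((v ⬝ᵥ v) / 2 * (v ⬝ᵥ (NormedSpace.exp N) *ᵥ v)) := by
    rw [← hasSum_nat_add_iff' 2]
    simp only [Finset.sum_range_succ, Finset.range_zero, Finset.sum_empty, Nat.cast_zero,
      Nat.cast_one, sub_self, zero_mul, mul_zero, zero_div, add_zero, sub_zero]
    refine ((hasSum_quadForm_exp N v).mul_left ((v ⬝ᵥ v) / 2)).congr_fun fun k => ?_
    rw [Nat.factorial_succ, Nat.factorial_succ, Nat.add_sub_cancel]
    push_cast
    field_simp
    ring
  have h3 := ((hasSum_trace_exp N).sub h1).add h2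
  refine (hasSum_le (fun k => ?_) (hasSum_trace_exp _) h3).trans (le_of_eq (by ring))
  have := mul_le_mul_of_nonneg_left (trace_pow_mul_pow_le hN v hN' k 0)
    (inv_nonneg.2 (Nat.cast_nonneg (α := ℝ) k.factorial))
  simp only [pow_zero, one_mul, add_zero] at this
  linarith

lemma posSemidef_sub_smul_one {M : Matrix n n ℝ} (hM : M.IsHermitian) {c : ℝ}
    (hc : ∀ x ∈ spectrum ℝ M, c ≤ x) : (M - c • (1 : Matrix n n ℝ)).PosSemidef := by
  refine Matrix.posSemidef_iff_isHermitian_and_spectrum_nonneg.2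
    ⟨hM.sub (Matrix.isHermitian_one.smul (IsSelfAdjoint.all c)), ?_⟩
  rw [← Algebra.algebraMap_eq_smul_one, ← spectrum.sub_singleton_eq]
  rintro _ ⟨x, hx, _, rfl, rfl⟩
  exact sub_nonneg.2 (hc x hx)

lemma exists_posSemidef_add_smul_one {M : Matrix n n ℝ} (hM : M.IsHermitian) :
    ∃ b : ℝ, ∀ c, b ≤ c → (M + c • (1 : Matrix n n ℝ)).PosSemidef := by
  obtain ⟨l, hl⟩ : BddBelow (spectrum ℝ M) := by
    rw [hM.spectrum_real_eq_range_eigenvalues]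
    exact (Set.finite_range _).bddBelow
  refine ⟨-l, fun c hc => ?_⟩
  have := posSemidef_sub_smul_one hM (c := -c) fun x hx => (neg_le.1 hc).trans (hl hx)
  rwa [neg_smul, sub_neg_eq_add] at this

lemma exp_add_smul_one (M : Matrix n n ℝ) (b : ℝ) :
    NormedSpace.exp (M + b • (1 : Matrix n n ℝ)) = Real.exp b • NormedSpace.exp M := by
  rw [Matrix.exp_add_of_commute _ _ ((Commute.one_right M).smul_right b),
    show b • (1 : Matrix n n ℝ) = Matrix.diagonal (fun _ => b) by
      rw [Matrix.smul_one_eq_diagonal], Matrix.exp_diagonal,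
    show NormedSpace.exp (fun _ : n => b) = fun _ => Real.exp b by
      ext i; rw [Pi.coe_exp, Real.exp_eq_exp_ℝ],
    ← Matrix.smul_one_eq_diagonal, mul_smul_comm, mul_one]

/-- A rank-one substitute for the Golden–Thompson inequality. A shift by a large multiple of the
identity makes both matrices positive semidefinite and multiplies both sides by the same factor. -/
lemma trace_exp_sub_vecMulVec_le {M : Matrix n n ℝ} (hM : M.IsHermitian) (v : n → ℝ) :
    (NormedSpace.exp (M - Matrix.vecMulVec v v)).trace ≤
      (NormedSpace.exp M).trace - (1 - (v ⬝ᵥ v) / 2) * (v ⬝ᵥ (NormedSpace.exp M) *ᵥ v) := by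
  have hv : (Matrix.vecMulVec v v).IsHermitian := by
    simpa using (Matrix.posSemidef_vecMulVec_self_star v).isHermitian
  obtain ⟨b₁, h₁⟩ := exists_posSemidef_add_smul_one hM
  obtain ⟨b₂, h₂⟩ := exists_posSemidef_add_smul_one (hM.sub hv)
  have e : M - Matrix.vecMulVec v v + max b₁ b₂ • (1 : Matrix n n ℝ) =
    M + max b₁ b₂ • (1 : Matrix n n ℝ) - Matrix.vecMulVec v v := by abel
  have h := trace_exp_sub_vecMulVec_le_of_posSemidef (h₁ _ (le_max_left b₁ b₂)) v
    (e ▸ h₂ _ (le_max_right b₁ b₂))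
  rw [← e, exp_add_smul_one, exp_add_smul_one, Matrix.trace_smul, Matrix.trace_smul,
    Matrix.smul_mulVec, dotProduct_smul, smul_eq_mul, smul_eq_mul, smul_eq_mul] at h
  refine le_of_mul_le_mul_left (h.trans_eq ?_) (Real.exp_pos (max b₁ b₂))
  ring

lemma exp_neg_eigenvalue_le_trace_exp_neg {S : Matrix n n ℝ} (hS : S.IsHermitian) (i : n) :
    Real.exp (-hS.eigenvalues i) ≤ (NormedSpace.exp (-S)).trace := by
  set U : Matrix n n ℝ := (hS.eigenvectorUnitary : Matrix n n ℝ) with hU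
  have hUU : U * star U = 1 := Unitary.coe_mul_star_self hS.eigenvectorUnitary
  have hUU' : star U * U = 1 := Unitary.coe_star_mul_self hS.eigenvectorUnitary
  have h : -S = U * Matrix.diagonal (fun i => -hS.eigenvalues i) * U⁻¹ := by
    conv_lhs => rw [hS.spectral_theorem]
    rw [← map_neg, Matrix.diagonal_neg, Unitary.conjStarAlgAut_apply, Matrix.inv_eq_right_inv hUU]
    rfl
  rw [h, Matrix.exp_conj _ _ (IsUnit.of_mul_eq_one _ hUU), Matrix.trace_mul_cycle,
    Matrix.inv_eq_right_inv hUU, hUU', one_mul, Matrix.exp_diagonal, Matrix.trace_diagonal]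
  simp_rw [Pi.coe_exp, ← Real.exp_eq_exp_ℝ]
  exact Finset.single_le_sum (f := fun i => Real.exp (-hS.eigenvalues i))
    (fun j _ => (Real.exp_pos _).le) (Finset.mem_univ i)

end RankOne

/-! ### A Chernoff bound for the smallest eigenvalue of a sample Gram matrix -/

section LowerTail

variable {n : Type*} [Fintype n] [DecidableEq n] {E : Type*} [MeasurableSpace E]
  {ν : Measure E} [IsProbabilityMeasure ν] {ξ : E → n → ℝ} {m lam : ℝ}

omit [DecidableEq n] in
lemma abs_apply_le_of_dotProduct_self_le {v : n → ℝ} (hv : v ⬝ᵥ v ≤ m) (i : n) : |v i| ≤ √m := by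
  refine Real.abs_le_sqrt (le_trans ?_ hv)
  rw [sq]
  exact Finset.single_le_sum (f := fun j => v j * v j) (fun j _ => mul_self_nonneg _)
    (Finset.mem_univ i)

omit [DecidableEq n] in
lemma integrable_apply_mul_apply (hξ : Measurable ξ) (hm : ∀ᵐ x ∂ν, ξ x ⬝ᵥ ξ x ≤ m) (i j : n) :
    Integrable (fun x => ξ x i * ξ x j) ν := by
  refine Integrable.of_bound (by fun_prop) (√m * √m) ?_
  filter_upwards [hm] with x hx
  rw [Real.norm_eq_abs, abs_mul]
  exact mul_le_mul (abs_apply_le_of_dotProduct_self_le hx i)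
    (abs_apply_le_of_dotProduct_self_le hx j) (abs_nonneg _) (Real.sqrt_nonneg _)

omit [DecidableEq n] in
lemma integrable_quadForm (hξ : Measurable ξ) (hm : ∀ᵐ x ∂ν, ξ x ⬝ᵥ ξ x ≤ m) (Q : Matrix n n ℝ) :
    Integrable (fun x => ξ x ⬝ᵥ Q *ᵥ ξ x) ν := by
  have e : (fun x => ξ x ⬝ᵥ Q *ᵥ ξ x) = fun x => ∑ i, ∑ j, Q i j * (ξ x i * ξ x j) := by
    ext x
    simp only [dotProduct, Matrix.mulVec, Finset.mul_sum]
    exact Finset.sum_congr rfl fun i _ => Finset.sum_congr rfl fun j _ => by ring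
  rw [e]
  exact integrable_finsetSum _ fun i _ => integrable_finsetSum _ fun j _ =>
    (integrable_apply_mul_apply hξ hm i j).const_mul _

/-- If the second moment matrix of `ξ` is at least `lam` times the identity, then `ξᵀ Q ξ` has mean at
least `lam * tr Q` for positive semidefinite `Q = Bᵀ B`: sum the hypothesis over the rows of `B`. -/
lemma mul_trace_le_integral_quadForm (hξ : Measurable ξ) (hm : ∀ᵐ x ∂ν, ξ x ⬝ᵥ ξ x ≤ m)
    (hlam : ∀ v : n → ℝ, lam * (v ⬝ᵥ v) ≤ ∫ x, (v ⬝ᵥ ξ x) ^ 2 ∂ν) {Q : Matrix n n ℝ}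
    (hQ : Q.PosSemidef) : lam * Q.trace ≤ ∫ x, ξ x ⬝ᵥ Q *ᵥ ξ x ∂ν := by
  obtain ⟨B, rfl⟩ : ∃ B : Matrix n n ℝ, Q = Bᵀ * B := by
    open scoped MatrixOrder in
    obtain ⟨B, hB⟩ := CStarAlgebra.nonneg_iff_eq_star_mul_self.1 hQ.nonneg
    exact ⟨B, hB⟩
  have e1 : (Bᵀ * B).trace = ∑ i, B i ⬝ᵥ B i := by
    rw [Matrix.trace_mul_comm]
    rfl
  have e2 : ∀ x, ξ x ⬝ᵥ (Bᵀ * B) *ᵥ ξ x = ∑ i, (B i ⬝ᵥ ξ x) ^ 2 := fun x => by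
    rw [← Matrix.mulVec_mulVec, Matrix.dotProduct_mulVec, Matrix.vecMul_transpose]
    exact Finset.sum_congr rfl fun i _ => (sq _).symm
  have e3 : ∀ v x, (v ⬝ᵥ ξ x) ^ 2 = ξ x ⬝ᵥ (Matrix.vecMulVec v v) *ᵥ ξ x := fun v x => by
    rw [Matrix.vecMulVec_mulVec, dotProduct_smul, dotProduct_comm (ξ x)]
    simp [sq]
  simp_rw [e1, e2]
  rw [integral_finsetSum _ fun i _ => by
    simp_rw [e3]; exact integrable_quadForm hξ hm _, Finset.mul_sum]
  exact Finset.sum_le_sum fun i _ => hlam _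

lemma posSemidef_exp {M : Matrix n n ℝ} (hM : M.IsHermitian) : (NormedSpace.exp M).PosSemidef := by
  have h : NormedSpace.exp M =
      (NormedSpace.exp ((2 : ℝ)⁻¹ • M))ᴴ * NormedSpace.exp ((2 : ℝ)⁻¹ • M) := by
    rw [((hM.smul (IsSelfAdjoint.all (2 : ℝ)⁻¹)).exp).eq,
      ← Matrix.exp_add_of_commute _ _ (Commute.refl _), ← add_smul]
    norm_num
  rw [h]
  exact Matrix.posSemidef_conjTranspose_mul_self _

omit [Fintype n] [DecidableEq n] in
lemma isHermitian_smul_vecMulVec (θ : ℝ) (v : n → ℝ) :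
    (θ • Matrix.vecMulVec v v).IsHermitian := by
  ext i j
  simp [Matrix.vecMulVec_apply, mul_comm]

omit [Fintype n] [DecidableEq n] in
lemma isHermitian_sum_smul_vecMulVec {L : ℕ} (θ : ℝ) (v : Fin L → n → ℝ) :
    (∑ l, θ • Matrix.vecMulVec (v l) (v l)).IsHermitian := by
  rw [Matrix.IsHermitian, Matrix.conjTranspose_sum]
  exact Finset.sum_congr rfl fun l _ => isHermitian_smul_vecMulVec θ (v l)

/-- Subtracting one random rank-one matrix `θ ξ ξᵀ` from `M` contracts the mean of `tr exp M`. -/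
lemma lintegral_trace_exp_sub_le (hξ : Measurable ξ) (hm : ∀ᵐ x ∂ν, ξ x ⬝ᵥ ξ x ≤ m)
    (hlam : ∀ v : n → ℝ, lam * (v ⬝ᵥ v) ≤ ∫ x, (v ⬝ᵥ ξ x) ^ 2 ∂ν) {θ : ℝ} (hθ : 0 ≤ θ)
    (hθm : θ * m ≤ 2) {M : Matrix n n ℝ} (hM : M.IsHermitian) :
    ∫⁻ x, ENNReal.ofReal (NormedSpace.exp (M - θ • Matrix.vecMulVec (ξ x) (ξ x))).trace ∂ν ≤
      ENNReal.ofReal (Real.exp (-(lam * (θ * (1 - θ * m / 2)))) * (NormedSpace.exp M).trace) := by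
  have hQ := posSemidef_exp hM
  set Q := NormedSpace.exp M
  set c := θ * (1 - θ * m / 2) with hc
  have hc0 : 0 ≤ c := mul_nonneg hθ (by linarith)
  have hb : ∀ᵐ x ∂ν, (NormedSpace.exp (M - θ • Matrix.vecMulVec (ξ x) (ξ x))).trace ≤
      Q.trace - c * (ξ x ⬝ᵥ Q *ᵥ ξ x) := by
    filter_upwards [hm] with x hx
    -- The summand `θ ξ ξᵀ` is the rank-one matrix of the vector `√θ • ξ`.
    have h := trace_exp_sub_vecMulVec_le hM (√θ • ξ x)
    rw [Matrix.smul_vecMulVec, Matrix.vecMulVec_smul, smul_smul, Real.mul_self_sqrt hθ,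
      Matrix.mulVec_smul, smul_dotProduct, smul_dotProduct, dotProduct_smul, dotProduct_smul,
      smul_smul, smul_smul, Real.mul_self_sqrt hθ, smul_eq_mul, smul_eq_mul] at h
    have h1 : 0 ≤ ξ x ⬝ᵥ Q *ᵥ ξ x := hQ.dotProduct_mulVec_nonneg _
    have h2 := mul_le_mul_of_nonneg_left (mul_le_mul_of_nonneg_left hx hθ) (mul_nonneg hθ h1)
    rw [hc]
    linarith
  have hint := integrable_quadForm hξ hm Q
  have hint2 : Integrable (fun x => Q.trace - c * (ξ x ⬝ᵥ Q *ᵥ ξ x)) ν :=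
    (integrable_const _).sub (hint.const_mul c)
  have hnn : ∀ᵐ x ∂ν, 0 ≤ Q.trace - c * (ξ x ⬝ᵥ Q *ᵥ ξ x) := by
    filter_upwards [hb] with x hx
    exact (posSemidef_exp (hM.sub (isHermitian_smul_vecMulVec θ (ξ x)))).trace_nonneg.trans hx
  calc _ ≤ ∫⁻ x, ENNReal.ofReal (Q.trace - c * (ξ x ⬝ᵥ Q *ᵥ ξ x)) ∂ν :=
        lintegral_mono_ae (hb.mono fun x hx => ENNReal.ofReal_le_ofReal hx)
    _ = ENNReal.ofReal (∫ x, (Q.trace - c * (ξ x ⬝ᵥ Q *ᵥ ξ x)) ∂ν) :=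
        (ofReal_integral_eq_lintegral_ofReal hint2 hnn).symm
    _ ≤ _ := by
        refine ENNReal.ofReal_le_ofReal ?_
        rw [integral_sub (integrable_const _) (hint.const_mul c), integral_const_mul]
        have h1 := mul_le_mul_of_nonneg_left (mul_trace_le_integral_quadForm hξ hm hlam hQ) hc0
        have h2 := mul_le_mul_of_nonneg_right (Real.add_one_le_exp (-(lam * c))) hQ.trace_nonneg
        simp only [integral_const, probReal_univ, one_smul]
        linarith

lemma measurable_trace_exp_sub_sum {L : ℕ} (hξ : Measurable ξ) (θ : ℝ) (M : Matrix n n ℝ) :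
    Measurable fun x : Fin L → E =>
      (NormedSpace.exp (M - ∑ l, θ • Matrix.vecMulVec (ξ (x l)) (ξ (x l)))).trace := by
  have hc : Continuous fun u : Fin L → n → ℝ =>
      (NormedSpace.exp (M - ∑ l, θ • Matrix.vecMulVec (u l) (u l))).trace := by
    have h1 : Continuous (NormedSpace.exp : Matrix n n ℝ → Matrix n n ℝ) := by
      open scoped Matrix.Norms.Operator in exact NormedSpace.exp_continuous
    have h2 : Continuous fun u : Fin L → n → ℝ =>
        M - ∑ l, θ • Matrix.vecMulVec (u l) (u l) :=
      continuous_const.sub (continuous_finsetSum _ fun l _ =>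
        Continuous.const_smul (g := fun u : Fin L → n → ℝ => Matrix.vecMulVec (u l) (u l))
          (Continuous.matrix_vecMulVec (continuous_apply l) (continuous_apply l)) θ)
    exact (h1.comp h2).matrix_trace
  exact hc.measurable.comp (measurable_pi_lambda _ fun l => hξ.comp (measurable_pi_apply l))

/-- Independent rank-one summands contract the mean of the trace exponential once each; the matrix
`M` is arbitrary so that the first summand can be absorbed into it. -/
lemma lintegral_pi_trace_exp_sub_le (hξ : Measurable ξ) (hm : ∀ᵐ x ∂ν, ξ x ⬝ᵥ ξ x ≤ m)
    (hlam : ∀ v : n → ℝ, lam * (v ⬝ᵥ v) ≤ ∫ x, (v ⬝ᵥ ξ x) ^ 2 ∂ν) {θ : ℝ} (hθ : 0 ≤ θ)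
    (hθm : θ * m ≤ 2) (L : ℕ) {M : Matrix n n ℝ} (hM : M.IsHermitian) :
    ∫⁻ x : Fin L → E, ENNReal.ofReal
      (NormedSpace.exp (M - ∑ l, θ • Matrix.vecMulVec (ξ (x l)) (ξ (x l)))).trace
        ∂Measure.pi (fun _ => ν) ≤
      ENNReal.ofReal (Real.exp (-(L * (lam * (θ * (1 - θ * m / 2))))) *
        (NormedSpace.exp M).trace) := by
  induction L generalizing M with
  | zero => simp
  | succ L ih =>
    set q := lam * (θ * (1 - θ * m / 2))
    have hmeas := (measurable_trace_exp_sub_sum (L := L + 1) hξ θ M).ennreal_ofReal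
    rw [← (measurePreserving_piFinSuccAbove (fun _ : Fin (L + 1) => ν) 0).symm.lintegral_comp
      hmeas]
    refine (lintegral_prod _ (hmeas.comp
        (MeasurableEquiv.piFinSuccAbove (fun _ : Fin (L + 1) => E) 0).symm.measurable).aemeasurable).trans_le ?_
    have hstep : ∀ x₀ : E, ∫⁻ x : Fin L → E, ENNReal.ofReal
        (NormedSpace.exp (M - ∑ l, θ • Matrix.vecMulVec
          (ξ ((MeasurableEquiv.piFinSuccAbove (fun _ : Fin (L + 1) => E) 0).symm (x₀, x) l))
          (ξ ((MeasurableEquiv.piFinSuccAbove (fun _ : Fin (L + 1) => E) 0).symm (x₀, x) l)))).trace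
            ∂Measure.pi (fun _ => ν) ≤
        ENNReal.ofReal (Real.exp (-(L * q))) * ENNReal.ofReal
          (NormedSpace.exp (M - θ • Matrix.vecMulVec (ξ x₀) (ξ x₀))).trace := fun x₀ => by
      rw [← ENNReal.ofReal_mul (Real.exp_pos _).le]
      refine le_trans (le_of_eq ?_) (ih (hM.sub (isHermitian_smul_vecMulVec θ (ξ x₀))))
      refine lintegral_congr fun x => ?_
      rw [Fin.sum_univ_succ]
      simp [MeasurableEquiv.piFinSuccAbove, sub_sub]
    refine (lintegral_mono hstep).trans ?_
    rw [lintegral_const_mul' _ _ ENNReal.ofReal_ne_top]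
    refine (mul_le_mul_right (lintegral_trace_exp_sub_le hξ hm hlam hθ hθm hM) _).trans ?_
    rw [← ENNReal.ofReal_mul (Real.exp_pos _).le, ← mul_assoc, ← Real.exp_add]
    refine ENNReal.ofReal_le_ofReal (le_of_eq ?_)
    congr 2
    push_cast
    ring

/-- Matrix Chernoff bound for the lower tail: the smallest eigenvalue of the sum of `L` independent
copies of `ξ ξᵀ` falls below `(1 - ε) L lam` with at most the stated probability. -/
theorem measure_not_posSemidef_sum_le (hξ : Measurable ξ) (hm : ∀ᵐ x ∂ν, ξ x ⬝ᵥ ξ x ≤ m)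
    (hm0 : 0 < m) (hlam : ∀ v : n → ℝ, lam * (v ⬝ᵥ v) ≤ ∫ x, (v ⬝ᵥ ξ x) ^ 2 ∂ν) {ε : ℝ}
    (hε0 : 0 < ε) (hε2 : ε ≤ 2) (L : ℕ) :
    Measure.pi (fun _ : Fin L => ν) {x | ¬ (∑ l, Matrix.vecMulVec (ξ (x l)) (ξ (x l)) -
      (L * ((1 - ε) * lam)) • (1 : Matrix n n ℝ)).PosSemidef} ≤
      ENNReal.ofReal (Fintype.card n * Real.exp (-(L * lam * ε ^ 2 / (2 * m)))) := by
  -- This `θ` minimizes the exponent `-ε θ + θ² m / 2`, up to the factor `L * lam`.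
  set θ := ε / m
  have hθ : 0 < θ := div_pos hε0 hm0
  have hθm : θ * m = ε := div_mul_cancel₀ _ hm0.ne'
  set c := L * ((1 - ε) * lam)
  set F : (Fin L → E) → ℝ := fun x =>
    (NormedSpace.exp (0 - ∑ l, θ • Matrix.vecMulVec (ξ (x l)) (ξ (x l)))).trace with hF
  have hsub : {x | ¬ (∑ l, Matrix.vecMulVec (ξ (x l)) (ξ (x l)) -
      c • (1 : Matrix n n ℝ)).PosSemidef} ⊆
      {x : Fin L → E | ENNReal.ofReal (Real.exp (-(θ * c))) ≤ ENNReal.ofReal (F x)} := by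
    intro x hx
    have hS := isHermitian_sum_smul_vecMulVec θ fun l => ξ (x l)
    refine ENNReal.ofReal_le_ofReal ?_
    -- An eigenvalue below `θ * c` would alone make the trace exceed `exp (-(θ * c))`.
    by_contra! hlt
    refine hx ?_
    have h := (posSemidef_sub_smul_one hS (c := θ * c) fun t ht => ?_).smul (inv_nonneg.2 hθ.le)
    · rwa [← Finset.smul_sum, mul_smul, ← smul_sub, inv_smul_smul₀ hθ.ne'] at h
    · rw [hS.spectrum_real_eq_range_eigenvalues] at ht
      obtain ⟨i, rfl⟩ := ht
      have := (exp_neg_eigenvalue_le_trace_exp_neg hS i).trans_lt (by simpa [hF] using hlt)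
      linarith [Real.exp_lt_exp.1 this]
  refine (measure_mono hsub).trans ?_
  refine (meas_ge_le_lintegral_div (measurable_trace_exp_sub_sum hξ θ 0).ennreal_ofReal.aemeasurable
    (by simp [Real.exp_pos]) ENNReal.ofReal_ne_top).trans ?_
  refine (ENNReal.div_le_div_right (lintegral_pi_trace_exp_sub_le hξ hm hlam hθ.le
    (hθm.trans_le hε2) L Matrix.isHermitian_zero) _).trans ?_
  rw [← ENNReal.ofReal_div_of_pos (Real.exp_pos _), NormedSpace.exp_zero, Matrix.trace_one]
  refine ENNReal.ofReal_le_ofReal (le_of_eq ?_)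
  rw [mul_comm, mul_div_assoc, ← Real.exp_sub]
  congr 2
  simp only [θ, c]
  field_simp
  ring

end LowerTail

/-! ### Truncated least squares -/

section LeastSquares

variable {K L : ℕ}

open Classical in
/-- The least-squares coefficient vector `(Aᵀ A)⁻¹ Aᵀ Y` if all eigenvalues of `Aᵀ A` are at least
`c`, and zero otherwise. The condition is written as positive semidefiniteness of `Aᵀ A - c I`. -/
noncomputable def truncatedLeastSquares (c : ℝ) (A : Matrix (Fin L) (Fin K) ℝ) (Y : Fin L → ℝ) : Fin K → ℝ :=
  if (Aᵀ * A - c • (1 : Matrix (Fin K) (Fin K) ℝ)).PosSemidef then (Aᵀ * A)⁻¹ *ᵥ Aᵀ *ᵥ Y else 0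

lemma isUnit_det_of_posSemidef_sub {S : Matrix (Fin K) (Fin K) ℝ} {c : ℝ} (hc : 0 < c)
    (hS : (S - c • (1 : Matrix (Fin K) (Fin K) ℝ)).PosSemidef) : IsUnit S.det := by
  have h : S.PosDef := by
    have := Matrix.PosDef.posSemidef_add hS (Matrix.PosDef.one.smul hc)
    rwa [sub_add_cancel] at this
  exact (Matrix.isUnit_iff_isUnit_det _).1 h.isUnit

lemma mul_dotProduct_self_le_quadForm {S : Matrix (Fin K) (Fin K) ℝ} {c : ℝ}
    (hS : (S - c • (1 : Matrix (Fin K) (Fin K) ℝ)).PosSemidef) (v : Fin K → ℝ) :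
    c * (v ⬝ᵥ v) ≤ v ⬝ᵥ S *ᵥ v := by
  have h := hS.dotProduct_mulVec_nonneg v
  rw [Matrix.sub_mulVec, dotProduct_sub, Matrix.smul_mulVec, Matrix.one_mulVec, dotProduct_smul,
    smul_eq_mul] at h
  exact sub_nonneg.1 h

/-- Stability of least squares: by the normal equations, `A (α - b)`, for the least-squares
solution `α`, is the orthogonal projection of the residual `Y - A b` onto the range of `A`. -/
lemma mul_dotProduct_truncatedLeastSquares_sub_le {c : ℝ} (hc : 0 < c)
    {A : Matrix (Fin L) (Fin K) ℝ} (hA : (Aᵀ * A - c • (1 : Matrix (Fin K) (Fin K) ℝ)).PosSemidef)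
    (Y : Fin L → ℝ) (b : Fin K → ℝ) :
    c * ((truncatedLeastSquares c A Y - b) ⬝ᵥ (truncatedLeastSquares c A Y - b)) ≤
      (Y - A *ᵥ b) ⬝ᵥ (Y - A *ᵥ b) := by
  set d := truncatedLeastSquares c A Y - b with hd
  set F := Y - A *ᵥ b with hF
  have h1 : (Aᵀ * A) *ᵥ d = Aᵀ *ᵥ F := by
    rw [hd, hF, truncatedLeastSquares, if_pos hA, Matrix.mulVec_sub, Matrix.mulVec_sub,
      Matrix.mulVec_mulVec, Matrix.mul_nonsing_inv _ (isUnit_det_of_posSemidef_sub hc hA),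
      Matrix.one_mulVec, Matrix.mulVec_mulVec]
  -- Hence `A d` is an orthogonal projection of `F`, and is not longer than `F`.
  have h2 : (A *ᵥ d) ⬝ᵥ (A *ᵥ d) = (A *ᵥ d) ⬝ᵥ F := by
    rw [dotProduct_comm _ F, Matrix.dotProduct_mulVec, Matrix.dotProduct_mulVec,
      ← Matrix.mulVec_transpose, ← Matrix.mulVec_transpose, Matrix.mulVec_mulVec, h1]
  have h3 := mul_dotProduct_self_le_quadForm hA d
  rw [← Matrix.mulVec_mulVec, Matrix.dotProduct_mulVec, Matrix.vecMul_transpose] at h3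
  have h4 : 0 ≤ (A *ᵥ d - F) ⬝ᵥ (A *ᵥ d - F) := Finset.sum_nonneg fun i _ => mul_self_nonneg _
  rw [sub_dotProduct, dotProduct_sub _ _ F, dotProduct_sub _ _ F, dotProduct_comm F] at h4
  linarith

/-- The hypothesis on `s` matters for `L < K`, where the entries `s k` with `L ≤ k` do not fit on the
diagonal. -/
lemma rectDiagonal_mul_transpose (s : Fin K → ℝ) (hs : ∀ k : Fin K, L ≤ (k : ℕ) → s k = 0) :
    rectDiagonal L s * (rectDiagonal L s)ᵀ = Matrix.diagonal fun k => s k ^ 2 := by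
  ext k k'
  rw [Matrix.mul_apply, Matrix.diagonal_apply]
  simp only [rectDiagonal, Matrix.transpose_apply, Matrix.of_apply]
  by_cases hk : (k : ℕ) < L
  · rw [Finset.sum_eq_single ⟨k, hk⟩]
    · by_cases h : k = k'
      · subst h; simp [sq]
      · have : (k' : ℕ) ≠ k := fun e => h (Fin.ext e.symm)
        simp [h, this]
    · intro l _ hl
      rw [if_neg fun e => hl (Fin.ext e.symm), zero_mul]
    · simp
  · rw [hs k (not_lt.1 hk)]
    simp

lemma IsSVD.transpose_mul_self {A : Matrix (Fin L) (Fin K) ℝ} {U : Matrix (Fin K) (Fin K) ℝ}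
    {s : Fin K → ℝ} {V : Matrix (Fin L) (Fin L) ℝ} (h : IsSVD A U s V) :
    Aᵀ * A = U * Matrix.diagonal (fun k => s k ^ 2) * Uᵀ := by
  have hV : V * Vᵀ = 1 := (Matrix.mem_orthogonalGroup_iff (Fin L) ℝ).1 h.right_orthogonal
  have hA : A = Vᵀ * (rectDiagonal L s)ᵀ * Uᵀ := by
    rw [← Matrix.transpose_transpose A, h.transpose_eq, Matrix.transpose_mul, Matrix.transpose_mul,
      Matrix.mul_assoc]
  rw [h.transpose_eq, hA, ← rectDiagonal_mul_transpose s h.eq_zero]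
  calc _ = U * rectDiagonal L s * (V * Vᵀ) * (rectDiagonal L s)ᵀ * Uᵀ := by
        simp only [Matrix.mul_assoc]
    _ = _ := by rw [hV]; simp only [Matrix.mul_assoc, Matrix.one_mul]

/-- The truncation criterion of the algorithm, in terms of the matrix `Aᵀ A` alone. -/
lemma IsSVD.posSemidef_sub_iff {A : Matrix (Fin L) (Fin K) ℝ} {U : Matrix (Fin K) (Fin K) ℝ}
    {s : Fin K → ℝ} {V : Matrix (Fin L) (Fin L) ℝ} (h : IsSVD A U s V) (hK : 0 < K) (c : ℝ) :
    (Aᵀ * A - c • (1 : Matrix (Fin K) (Fin K) ℝ)).PosSemidef ↔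
      c ≤ s ⟨K - 1, Nat.sub_lt hK Nat.one_pos⟩ ^ 2 := by
  have hU : U * Uᵀ = 1 := (Matrix.mem_orthogonalGroup_iff (Fin K) ℝ).1 h.left_orthogonal
  have hU' : Uᵀ * U = 1 := (Matrix.mem_orthogonalGroup_iff' (Fin K) ℝ).1 h.left_orthogonal
  have e1 : Aᵀ * A - c • (1 : Matrix (Fin K) (Fin K) ℝ) =
      U * Matrix.diagonal (fun k => s k ^ 2 - c) * Uᵀ := by
    rw [h.transpose_mul_self, ← Matrix.diagonal_sub, Matrix.mul_sub, Matrix.sub_mul,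
      ← Matrix.smul_one_eq_diagonal c, Matrix.mul_smul, Matrix.mul_one, Matrix.smul_mul, hU]
  have e2 : Matrix.diagonal (fun k => s k ^ 2 - c) =
      Uᵀ * (Aᵀ * A - c • (1 : Matrix (Fin K) (Fin K) ℝ)) * U := by
    rw [e1]
    calc _ = (Uᵀ * U) * Matrix.diagonal (fun k => s k ^ 2 - c) * (Uᵀ * U) := by
          rw [hU', Matrix.one_mul, Matrix.mul_one]
      _ = _ := by simp only [Matrix.mul_assoc]
  constructor
  · intro hp
    have := hp.conjTranspose_mul_mul_same U
    rw [Matrix.conjTranspose_eq_transpose_of_trivial, ← e2, Matrix.posSemidef_diagonal_iff] at this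
    exact sub_nonneg.1 (this _)
  · intro hc
    rw [e1, ← Matrix.conjTranspose_eq_transpose_of_trivial]
    refine Matrix.PosSemidef.mul_mul_conjTranspose_same
      (Matrix.posSemidef_diagonal_iff.2 fun k => sub_nonneg.2 (hc.trans ?_)) U
    exact pow_le_pow_left₀ (h.nonneg _) (h.antitone (Fin.le_def.2 (by simp; lia))) 2

/-- The output of the algorithm does not depend on the singular value decomposition. -/
theorem IsBruteForceSVDCoeff.eq_truncatedLeastSquares {hK : 0 < K} {τ : ℝ}
    {A : Matrix (Fin L) (Fin K) ℝ} {Y : Fin L → ℝ} {a : Fin K → ℝ}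
    (h : IsBruteForceSVDCoeff hK τ A Y a) (hτ : 0 < L * τ) :
    a = truncatedLeastSquares (L * τ) A Y := by
  obtain ⟨U, s, V, hsvd, h1, h2⟩ := h
  rw [truncatedLeastSquares]
  split_ifs with hp
  · have hs := (hsvd.posSemidef_sub_iff hK _).1 hp
    have hs0 : ∀ k, s k ≠ 0 := fun k hk => by
      have h3 : s ⟨K - 1, Nat.sub_lt hK Nat.one_pos⟩ = 0 :=
        le_antisymm ((hsvd.antitone (Fin.le_def.2 (by simp; lia))).trans_eq hk) (hsvd.nonneg _)
      rw [h3] at hs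
      norm_num at hs
      linarith
    have hU' : Uᵀ * U = 1 := (Matrix.mem_orthogonalGroup_iff' (Fin K) ℝ).1 hsvd.left_orthogonal
    have hD : Matrix.diagonal (fun k => s k ^ 2) * rectDiagonal L (fun k => (s k)⁻¹) =
        rectDiagonal L s := by
      ext k l
      rw [Matrix.diagonal_mul]
      simp only [rectDiagonal, Matrix.of_apply]
      split_ifs
      · rw [sq, mul_assoc, mul_inv_cancel₀ (hs0 k), mul_one]
      · rw [mul_zero]
    have e : (Aᵀ * A) * (U * rectDiagonal L (fun k => (s k)⁻¹) * V) = Aᵀ := by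
      rw [hsvd.transpose_mul_self, hsvd.transpose_eq, ← hD]
      calc _ = U * Matrix.diagonal (fun k => s k ^ 2) * (Uᵀ * U) *
            rectDiagonal L (fun k => (s k)⁻¹) * V := by simp only [Matrix.mul_assoc]
        _ = _ := by rw [hU']; simp only [Matrix.mul_assoc, Matrix.one_mul]
    rw [h1 hs, Matrix.mulVec_mulVec]
    congr 1
    refine Eq.trans ?_ (congrArg ((Aᵀ * A)⁻¹ * ·) e)
    exact (Matrix.nonsing_inv_mul_cancel_left _ _ (isUnit_det_of_posSemidef_sub hτ hp)).symm
  · exact h2 (not_le.1 fun hle => hp ((hsvd.posSemidef_sub_iff hK _).2 hle))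

/-- Matrices carry no `MeasurableSpace` instance, so measurability is expressed entrywise. -/
lemma measurableSet_mem_of_isClosed {E : Type*} [MeasurableSpace E]
    {S : E → Matrix (Fin K) (Fin K) ℝ} (hS : ∀ i j, Measurable fun x => S x i j)
    {C : Set (Matrix (Fin K) (Fin K) ℝ)} (hC : IsClosed C) : MeasurableSet {x | S x ∈ C} := by
  have h : Measurable (fun x i j => S x i j) :=
    measurable_pi_lambda _ fun i => measurable_pi_lambda _ fun j => hS i j
  have hC' : IsClosed {u : Fin K → Fin K → ℝ | Matrix.of u ∈ C} := hC
  exact h hC'.measurableSet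

lemma measurable_comp_of_continuous {E : Type*} [MeasurableSpace E]
    {S : E → Matrix (Fin K) (Fin K) ℝ} (hS : ∀ i j, Measurable fun x => S x i j)
    {φ : Matrix (Fin K) (Fin K) ℝ → ℝ} (hφ : Continuous φ) : Measurable fun x => φ (S x) := by
  have h : Measurable (fun x i j => S x i j) :=
    measurable_pi_lambda _ fun i => measurable_pi_lambda _ fun j => hS i j
  have hφ' : Continuous fun u : Fin K → Fin K → ℝ => φ (Matrix.of u) := hφ
  exact hφ'.measurable.comp h

lemma isClosed_setOf_posSemidef_sub (c : ℝ) :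
    IsClosed {S : Matrix (Fin K) (Fin K) ℝ | (S - c • (1 : Matrix (Fin K) (Fin K) ℝ)).PosSemidef} := by
  have e : {S : Matrix (Fin K) (Fin K) ℝ | (S - c • (1 : Matrix (Fin K) (Fin K) ℝ)).PosSemidef} =
      {S | (S - c • 1)ᴴ = S - c • 1} ∩ ⋂ v : Fin K → ℝ, {S | 0 ≤ star v ⬝ᵥ (S - c • 1) *ᵥ v} := by
    ext S
    simp [Matrix.posSemidef_iff_dotProduct_mulVec, Matrix.IsHermitian]
  have hc : Continuous fun S : Matrix (Fin K) (Fin K) ℝ =>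
      S - c • (1 : Matrix (Fin K) (Fin K) ℝ) := continuous_id.sub continuous_const
  rw [e]
  exact (isClosed_eq hc.matrix_conjTranspose hc).inter (isClosed_iInter fun v =>
    isClosed_le continuous_const (continuous_const.dotProduct (hc.matrix_mulVec continuous_const)))

variable {E : Type*} [MeasurableSpace E] {A : E → Matrix (Fin L) (Fin K) ℝ}

lemma measurable_transpose_mul_self_apply (hA : ∀ l k, Measurable fun x => A x l k) (i j : Fin K) :
    Measurable fun x => ((A x)ᵀ * A x) i j := by
  simp only [Matrix.mul_apply, Matrix.transpose_apply]
  exact Finset.measurable_sum _ fun l _ => (hA l i).mul (hA l j)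

lemma measurableSet_posSemidef_sub (hA : ∀ l k, Measurable fun x => A x l k) (c : ℝ) :
    MeasurableSet {x | ((A x)ᵀ * A x - c • (1 : Matrix (Fin K) (Fin K) ℝ)).PosSemidef} :=
  measurableSet_mem_of_isClosed (measurable_transpose_mul_self_apply hA)
    (isClosed_setOf_posSemidef_sub c)

lemma measurable_truncatedLeastSquares (hA : ∀ l k, Measurable fun x => A x l k)
    {Y : E → Fin L → ℝ} (hY : ∀ l, Measurable fun x => Y x l) (c : ℝ) :
    Measurable fun x => truncatedLeastSquares c (A x) (Y x) := by
  refine Measurable.ite (measurableSet_posSemidef_sub hA c) ?_ measurable_const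
  refine measurable_pi_lambda _ fun k => ?_
  simp only [Matrix.mulVec, dotProduct, Matrix.inv_def, Matrix.smul_apply, Ring.inverse_eq_inv',
    smul_eq_mul, Matrix.transpose_apply]
  have hS := measurable_transpose_mul_self_apply hA
  refine Finset.measurable_sum _ fun j _ => ((measurable_comp_of_continuous hS
    continuous_id.matrix_det).inv.mul (measurable_comp_of_continuous hS
      (continuous_id.matrix_adjugate.matrix_elem k j))).mul
    (Finset.measurable_sum _ fun l _ => (hA l j).mul (hY l))

end LeastSquares

/-! ### The error of the least-squares estimator in mean square -/

section Projection

variable {D K : ℕ} {μ : Measure (EuclideanSpace ℝ (Fin D))}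
  {η : Fin K → EuclideanSpace ℝ (Fin D) → ℝ} {y : EuclideanSpace ℝ (Fin D) → ℝ}

lemma memLp_of_measurable_of_bounded [IsProbabilityMeasure μ] (hη : ∀ k, Measurable (η k))
    (hbdd : ∀ k, ∃ C : ℝ, ∀ x, |η k x| ≤ C) (k : Fin K) : MemLp (η k) 2 μ := by
  obtain ⟨C, hC⟩ := hbdd k
  exact MemLp.of_bound (hη k).aestronglyMeasurable C (Filter.Eventually.of_forall hC)

lemma integrable_fun_mul {f g : EuclideanSpace ℝ (Fin D) → ℝ} (hf : MemLp f 2 μ)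
    (hg : MemLp g 2 μ) : Integrable (fun x => f x * g x) μ :=
  hf.integrable_mul hg

lemma memLp_sum_mul (hη2 : ∀ k, MemLp (η k) 2 μ) (a : Fin K → ℝ) :
    MemLp (fun x => ∑ k, a k * η k x) 2 μ :=
  memLp_finsetSum _ fun k _ => (hη2 k).const_mul (a k)

lemma lintegral_ofReal_abs_sq {f : EuclideanSpace ℝ (Fin D) → ℝ} (hf : MemLp f 2 μ) :
    ∫⁻ x, ENNReal.ofReal (|f x| ^ 2) ∂μ = ENNReal.ofReal (∫ x, f x ^ 2 ∂μ) := by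
  simp_rw [sq_abs]
  exact (ofReal_integral_eq_lintegral_ofReal hf.integrable_sq
    (Filter.Eventually.of_forall fun x => sq_nonneg _)).symm

lemma memLp_two_of_lintegral_ne_top (hy : Measurable y)
    (h : ∫⁻ x, ENNReal.ofReal (|y x| ^ 2) ∂μ ≠ ∞) : MemLp y 2 μ := by
  refine (memLp_two_iff_integrable_sq hy.aestronglyMeasurable).2 ?_
  simp_rw [sq_abs] at h
  exact (lintegral_ofReal_ne_top_iff_integrable (hy.pow_const 2).aestronglyMeasurable
    (Filter.Eventually.of_forall fun x => sq_nonneg _)).1 h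

lemma integral_mul_sum_mul (hη2 : ∀ k, MemLp (η k) 2 μ) {f : EuclideanSpace ℝ (Fin D) → ℝ}
    (hf : MemLp f 2 μ) (d : Fin K → ℝ) :
    ∫ x, f x * ∑ k, d k * η k x ∂μ = ∑ k, d k * ∫ x, f x * η k x ∂μ := by
  have : ∀ x, f x * ∑ k, d k * η k x = ∑ k, d k * (f x * η k x) := fun x => by
    rw [Finset.mul_sum]; exact Finset.sum_congr rfl fun k _ => by ring
  simp_rw [this]
  rw [integral_finsetSum _ fun k _ => (integrable_fun_mul hf (hη2 k)).const_mul (d k)]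
  simp_rw [integral_const_mul]

lemma gramMatrix_mulVec_apply (hη2 : ∀ k, MemLp (η k) 2 μ) (d : Fin K → ℝ) (k : Fin K) :
    (gramMatrix μ η *ᵥ d) k = ∫ x, η k x * ∑ j, d j * η j x ∂μ := by
  rw [integral_mul_sum_mul hη2 (hη2 k)]
  simp [Matrix.mulVec, dotProduct, gramMatrix, mul_comm]

lemma quadForm_gramMatrix (hη2 : ∀ k, MemLp (η k) 2 μ) (d : Fin K → ℝ) :
    d ⬝ᵥ gramMatrix μ η *ᵥ d = ∫ x, (∑ k, d k * η k x) ^ 2 ∂μ := by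
  simp_rw [sq]
  rw [integral_mul_sum_mul hη2 (memLp_sum_mul hη2 d)]
  simp [dotProduct, gramMatrix_mulVec_apply hη2, mul_comm]

lemma isHermitian_gramMatrix : (gramMatrix μ η).IsHermitian := by
  ext i j
  simp [gramMatrix, mul_comm]

lemma finite_spectrum_gramMatrix : (spectrum ℝ (gramMatrix μ η)).Finite := by
  rw [isHermitian_gramMatrix.spectrum_real_eq_range_eigenvalues]
  exact Set.finite_range _

lemma posSemidef_gramMatrix_sub {c : ℝ} (h : c ≤ minEigenvalue (gramMatrix μ η)) :
    (gramMatrix μ η - c • (1 : Matrix (Fin K) (Fin K) ℝ)).PosSemidef :=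
  posSemidef_sub_smul_one isHermitian_gramMatrix fun _ hx =>
    h.trans (csInf_le finite_spectrum_gramMatrix.bddBelow hx)

lemma quadForm_gramMatrix_le {c : ℝ} (h : maxEigenvalue (gramMatrix μ η) ≤ c) (v : Fin K → ℝ) :
    v ⬝ᵥ gramMatrix μ η *ᵥ v ≤ c * (v ⬝ᵥ v) := by
  have h1 := mul_dotProduct_self_le_quadForm (posSemidef_sub_smul_one
    (isHermitian_gramMatrix (μ := μ) (η := η)).neg (c := -c) fun x hx => by
      rw [← spectrum.neg_eq] at hx
      exact neg_le.1 ((le_csSup finite_spectrum_gramMatrix.bddAbove hx).trans h)) v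
  rw [Matrix.neg_mulVec, dotProduct_neg] at h1
  linarith

/-- The normal equations of the projection onto the span of the `η_k` are solvable. -/
lemma exists_orthogonal_residual (hη2 : ∀ k, MemLp (η k) 2 μ) (hy2 : MemLp y 2 μ)
    (hR : IsUnit (gramMatrix μ η).det) :
    ∃ b : Fin K → ℝ, ∀ k, ∫ x, (y x - ∑ j, b j * η j x) * η k x ∂μ = 0 := by
  refine ⟨(gramMatrix μ η)⁻¹ *ᵥ fun k => ∫ x, y x * η k x ∂μ, fun k => ?_⟩
  set b := (gramMatrix μ η)⁻¹ *ᵥ fun k => ∫ x, y x * η k x ∂μ with hb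
  have h : (gramMatrix μ η *ᵥ b) k = ∫ x, y x * η k x ∂μ := by
    rw [hb, Matrix.mulVec_mulVec, Matrix.mul_nonsing_inv _ hR, Matrix.one_mulVec]
  rw [gramMatrix_mulVec_apply hη2] at h
  simp_rw [sub_mul]
  rw [integral_sub (integrable_fun_mul hy2 (hη2 k))
      (integrable_fun_mul (memLp_sum_mul hη2 b) (hη2 k)), ← h,
    sub_eq_zero]
  simp_rw [mul_comm]

/-- Pythagoras, where `b` is the coefficient vector of the orthogonal projection of `y`. -/
lemma sqError_eq_of_orthogonal (hη2 : ∀ k, MemLp (η k) 2 μ) (hy2 : MemLp y 2 μ) {b : Fin K → ℝ}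
    (hb : ∀ k, ∫ x, (y x - ∑ j, b j * η j x) * η k x ∂μ = 0) (a : Fin K → ℝ) :
    sqError μ η y a = sqError μ η y b +
      ENNReal.ofReal ((a - b) ⬝ᵥ gramMatrix μ η *ᵥ (a - b)) := by
  have hf : ∀ a : Fin K → ℝ, MemLp (fun x => y x - ∑ j, a j * η j x) 2 μ := fun a =>
    hy2.sub (memLp_sum_mul hη2 a)
  have hg := memLp_sum_mul hη2 (a - b)
  have e : ∀ x, (y x - ∑ j, a j * η j x) ^ 2 =
      ((y x - ∑ j, b j * η j x) ^ 2 -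
        2 * ((y x - ∑ j, b j * η j x) * ∑ j, (a - b) j * η j x)) +
        (∑ j, (a - b) j * η j x) ^ 2 := fun x => by
    have : ∑ j, (a - b) j * η j x = ∑ j, a j * η j x - ∑ j, b j * η j x := by
      simp only [Pi.sub_apply, sub_mul, Finset.sum_sub_distrib]
    rw [this]; ring
  rw [sqError, sqError, lintegral_ofReal_abs_sq (hf a), lintegral_ofReal_abs_sq (hf b),
    quadForm_gramMatrix hη2, ← ENNReal.ofReal_add (integral_nonneg fun x => sq_nonneg _)
      (integral_nonneg fun x => sq_nonneg _)]
  simp_rw [e]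
  have hi := (integrable_fun_mul (hf b) hg).const_mul 2
  rw [integral_add (f := fun x => (y x - ∑ j, b j * η j x) ^ 2 -
      2 * ((y x - ∑ j, b j * η j x) * ∑ j, (a - b) j * η j x)) ((hf b).integrable_sq.sub hi) hg.integrable_sq,
    integral_sub (hf b).integrable_sq hi, integral_const_mul, integral_mul_sum_mul hη2 (hf b)]
  simp [hb]

lemma measurable_sqError [IsProbabilityMeasure μ] (hy : Measurable y) (hη : ∀ k, Measurable (η k)) :
    Measurable fun a : Fin K → ℝ => sqError μ η y a := by
  refine Measurable.lintegral_prod_right' (f := fun p : (Fin K → ℝ) × EuclideanSpace ℝ (Fin D) =>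
    ENNReal.ofReal (|y p.2 - ∑ k, p.1 k * η k p.2| ^ 2)) ?_
  have : ∀ k, Measurable fun p : (Fin K → ℝ) × EuclideanSpace ℝ (Fin D) => p.1 k * η k p.2 :=
    fun k => ((measurable_pi_apply k).comp measurable_fst).mul ((hη k).comp measurable_snd)
  have := Finset.measurable_sum Finset.univ fun k _ => this k
  fun_prop

/-- The truncated least-squares coefficient vector as a function of the sample points. -/
noncomputable abbrev sampleCoeff {L : ℕ} (η : Fin K → EuclideanSpace ℝ (Fin D) → ℝ)
    (y : EuclideanSpace ℝ (Fin D) → ℝ) (c : ℝ) (x : Fin L → EuclideanSpace ℝ (Fin D)) : Fin K → ℝ :=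
  truncatedLeastSquares c (regressionMatrix η x) fun l => y (x l)

/-- Pointwise error bound: the first summand dominates on the event that the truncation criterion is
passed, the second on its complement, where the estimator is zero. -/
lemma sqError_sampleCoeff_le {L : ℕ} (hη2 : ∀ k, MemLp (η k) 2 μ) (hy2 : MemLp y 2 μ)
    {b : Fin K → ℝ} (hb : ∀ k, ∫ x, (y x - ∑ j, b j * η j x) * η k x ∂μ = 0) {lamUp c : ℝ}
    (hmax : maxEigenvalue (gramMatrix μ η) ≤ lamUp) (hlamUp : 0 ≤ lamUp) (hc : 0 < c)
    (x : Fin L → EuclideanSpace ℝ (Fin D)) :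
    sqError μ η y (sampleCoeff η y c x) ≤
      (sqError μ η y b + ENNReal.ofReal (lamUp / c) *
        ∑ l, ENNReal.ofReal (|y (x l) - ∑ k, b k * η k (x l)| ^ 2)) +
      {x : Fin L → EuclideanSpace ℝ (Fin D) | ¬ ((regressionMatrix η x)ᵀ * regressionMatrix η x -
        c • (1 : Matrix (Fin K) (Fin K) ℝ)).PosSemidef}.indicator
          (fun _ => ∫⁻ x, ENNReal.ofReal (|y x| ^ 2) ∂μ) x := by
  by_cases hp : ((regressionMatrix η x)ᵀ * regressionMatrix η x -
        c • (1 : Matrix (Fin K) (Fin K) ℝ)).PosSemidef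
  · refine le_trans ?_ le_self_add
    rw [sqError_eq_of_orthogonal hη2 hy2 hb]
    refine add_le_add_right ?_ _
    rw [← ENNReal.ofReal_sum_of_nonneg fun l _ => sq_nonneg _,
      ← ENNReal.ofReal_mul (div_nonneg hlamUp hc.le)]
    refine ENNReal.ofReal_le_ofReal ((quadForm_gramMatrix_le hmax _).trans ?_)
    have h := mul_dotProduct_truncatedLeastSquares_sub_le hc hp (fun l => y (x l)) b
    have e : ((fun l => y (x l)) - regressionMatrix η x *ᵥ b) ⬝ᵥ
        ((fun l => y (x l)) - regressionMatrix η x *ᵥ b) =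
        ∑ l, |y (x l) - ∑ k, b k * η k (x l)| ^ 2 := by
      simp [dotProduct, regressionMatrix, Matrix.mulVec, sq, mul_comm]
    rw [e] at h
    calc _ = lamUp / c * (c * ((sampleCoeff η y c x - b) ⬝ᵥ (sampleCoeff η y c x - b))) := by
          field_simp
      _ ≤ _ := mul_le_mul_of_nonneg_left h (div_nonneg hlamUp hc.le)
  · refine le_trans (le_of_eq ?_) le_add_self
    rw [Set.indicator_of_mem (by exact hp), sampleCoeff, truncatedLeastSquares, if_neg hp, sqError]
    simp

lemma regressionMatrix_transpose_mul_self {L : ℕ} (x : Fin L → EuclideanSpace ℝ (Fin D)) :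
    (regressionMatrix η x)ᵀ * regressionMatrix η x =
      ∑ l, Matrix.vecMulVec (fun k => η k (x l)) (fun k => η k (x l)) := by
  ext i j
  simp [Matrix.mul_apply, regressionMatrix, Matrix.sum_apply, Matrix.vecMulVec_apply]

lemma measurable_regressionMatrix_apply {L : ℕ} (hη : ∀ k, Measurable (η k)) (l : Fin L)
    (k : Fin K) : Measurable fun x : Fin L → EuclideanSpace ℝ (Fin D) => regressionMatrix η x l k :=
  (hη k).comp (measurable_pi_apply l)

lemma measurable_sampleCoeff {L : ℕ} (hy : Measurable y) (hη : ∀ k, Measurable (η k)) (c : ℝ) :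
    Measurable (sampleCoeff (L := L) η y c) :=
  measurable_truncatedLeastSquares (measurable_regressionMatrix_apply hη)
    (fun l => hy.comp (measurable_pi_apply l)) c

lemma measurable_residual (hy : Measurable y) (hη : ∀ k, Measurable (η k)) (b : Fin K → ℝ) :
    Measurable fun z => ENNReal.ofReal (|y z - ∑ k, b k * η k z| ^ 2) := by
  have := Finset.measurable_sum Finset.univ fun k _ => (hη k).const_mul (b k)
  fun_prop

lemma lintegral_pi_sum_residual [IsProbabilityMeasure μ] {L : ℕ} (hy : Measurable y)
    (hη : ∀ k, Measurable (η k)) (b : Fin K → ℝ) :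
    ∫⁻ x, ∑ l, ENNReal.ofReal (|y (x l) - ∑ k, b k * η k (x l)| ^ 2)
      ∂Measure.pi (fun _ : Fin L => μ) = L * sqError μ η y b := by
  have hres := measurable_residual hy hη b
  have hml : ∀ l : Fin L, Measurable fun x : Fin L → EuclideanSpace ℝ (Fin D) =>
      ENNReal.ofReal (|y (x l) - ∑ k, b k * η k (x l)| ^ 2) := fun l =>
    hres.comp (measurable_pi_apply l)
  rw [lintegral_finsetSum _ fun l _ => hml l]
  have hl : ∀ l : Fin L, ∫⁻ x : Fin L → EuclideanSpace ℝ (Fin D),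
      ENNReal.ofReal (|y (x l) - ∑ k, b k * η k (x l)| ^ 2) ∂Measure.pi (fun _ => μ) =
      sqError μ η y b := fun l =>
    (measurePreserving_eval (fun _ : Fin L => μ) l).lintegral_comp hres
  simp_rw [hl]
  simp

/-- The mean error, in terms of the probability that the truncation criterion fails. The expected sum
of squared residuals over the sample is `L` times the best error, which cancels the factor `L` in
the threshold `L * τ`. -/
lemma lintegral_sqError_sampleCoeff_le {L : ℕ} [IsProbabilityMeasure μ] (hy : Measurable y) (hη : ∀ k, Measurable (η k))
    (hη2 : ∀ k, MemLp (η k) 2 μ) (hy2 : MemLp y 2 μ) (hR : IsUnit (gramMatrix μ η).det)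
    {lamUp τ : ℝ} (hmax : maxEigenvalue (gramMatrix μ η) ≤ lamUp) (hlamUp : 0 ≤ lamUp) (hτ : 0 < τ)
    (hL : 0 < L) :
    ∫⁻ x, sqError μ η y (sampleCoeff η y (L * τ) x) ∂Measure.pi (fun _ : Fin L => μ) ≤
      ENNReal.ofReal (1 + lamUp / τ) * (⨅ a, sqError μ η y a) +
      Measure.pi (fun _ : Fin L => μ) {x | ¬ ((regressionMatrix η x)ᵀ * regressionMatrix η x -
        (L * τ) • (1 : Matrix (Fin K) (Fin K) ℝ)).PosSemidef} *
        ∫⁻ x, ENNReal.ofReal (|y x| ^ 2) ∂μ := by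
  obtain ⟨b, hb⟩ := exists_orthogonal_residual hη2 hy2 hR
  have hinf : ⨅ a, sqError μ η y a = sqError μ η y b :=
    le_antisymm (iInf_le _ b) (le_iInf fun a => by
      rw [sqError_eq_of_orthogonal hη2 hy2 hb a]; exact le_self_add)
  have hL' : (0 : ℝ) < L := Nat.cast_pos.2 hL
  refine (lintegral_mono fun x => sqError_sampleCoeff_le hη2 hy2 hb hmax hlamUp
    (mul_pos hL' hτ) x).trans ?_
  have hres := measurable_residual hy hη b
  have hmeas : Measurable fun x : Fin L → EuclideanSpace ℝ (Fin D) =>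
      sqError μ η y b + ENNReal.ofReal (lamUp / (L * τ)) *
        ∑ l, ENNReal.ofReal (|y (x l) - ∑ k, b k * η k (x l)| ^ 2) :=
    measurable_const.add ((Finset.measurable_sum _ fun l _ =>
      hres.comp (measurable_pi_apply l)).const_mul _)
  rw [lintegral_add_left hmeas]
  refine add_le_add (le_of_eq ?_) ((lintegral_indicator_const_le _ _).trans_eq (mul_comm _ _))
  rw [lintegral_add_left measurable_const, lintegral_const_mul' _ _ ENNReal.ofReal_ne_top,
    lintegral_pi_sum_residual hy hη, hinf, lintegral_const, measure_univ, mul_one, ← mul_assoc,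
    ← ENNReal.ofReal_natCast,
    ← ENNReal.ofReal_mul (div_nonneg hlamUp (mul_pos hL' hτ).le),
    ENNReal.ofReal_add zero_le_one (div_nonneg hlamUp hτ.le), ENNReal.ofReal_one, add_mul, one_mul]
  congr 3
  field_simp

end Projection

/-! ### The error bound -/

/-- The supremum over the support is a genuine one, by boundedness of the `η_k`. -/
lemma ae_sum_sq_le_iSup_support {D K : ℕ} {μ : Measure (EuclideanSpace ℝ (Fin D))}
    {η : Fin K → EuclideanSpace ℝ (Fin D) → ℝ} (hbdd : ∀ k, ∃ C : ℝ, ∀ x, |η k x| ≤ C) :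
    ∀ᵐ x ∂μ, (fun k => η k x) ⬝ᵥ (fun k => η k x) ≤ ⨆ x : μ.support, ∑ k, |η k x| ^ 2 := by
  choose C hC using hbdd
  have hb : BddAbove (Set.range fun x : μ.support => ∑ k, |η k x| ^ 2) := by
    refine ⟨∑ k, C k ^ 2, ?_⟩
    rintro _ ⟨x, rfl⟩
    exact Finset.sum_le_sum fun k _ => pow_le_pow_left₀ (abs_nonneg _) (hC k x) 2
  filter_upwards [Measure.support_mem_ae] with x hx
  refine le_trans (le_of_eq ?_) (le_ciSup hb ⟨x, hx⟩)
  simp [dotProduct, sq]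

/-- The Chernoff bound is at most the bound of Bernstein type, since `lamLow ≤ lamUp`. -/
lemma mul_exp_neg_le {K L m lamLow lamUp ε : ℝ} (hK : 0 ≤ K) (hL : 0 ≤ L) (hm : 0 < m)
    (hlamLow : 0 < lamLow) (hlam : lamLow ≤ lamUp) (hε : 0 < ε) :
    K * Real.exp (-(L * lamLow * ε ^ 2 / (2 * m))) ≤
      2 * K * Real.exp (-(3 * ε ^ 2 * L /
        (6 * m * lamUp / lamLow ^ 2 + 2 * ε * (m / lamLow + lamUp / lamLow)))) := by
  have hlamUp : 0 < lamUp := hlamLow.trans_le hlam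
  have h1 : 6 * m / lamLow ≤
      6 * m * lamUp / lamLow ^ 2 + 2 * ε * (m / lamLow + lamUp / lamLow) := by
    have : 6 * m / lamLow ≤ 6 * m * lamUp / lamLow ^ 2 := by
      rw [div_le_div_iff₀ hlamLow (by positivity)]
      have := mul_le_mul_of_nonneg_left hlam (show 0 ≤ 6 * m * lamLow by positivity)
      linarith
    have : 0 ≤ 2 * ε * (m / lamLow + lamUp / lamLow) := by positivity
    linarith
  have h2 : 3 * ε ^ 2 * L /
      (6 * m * lamUp / lamLow ^ 2 + 2 * ε * (m / lamLow + lamUp / lamLow)) ≤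
      L * lamLow * ε ^ 2 / (2 * m) := by
    refine (div_le_div_of_nonneg_left (by positivity) (by positivity) h1).trans_eq ?_
    field_simp
    ring
  exact mul_le_mul (by linarith) (Real.exp_le_exp.2 (neg_le_neg h2)) (Real.exp_pos _).le
    (by linarith)

theorem theorem4p1 {Ω : Type*} [MeasurableSpace Ω] (P : Measure Ω) [IsProbabilityMeasure P]
    {D K L : ℕ} (hK : 0 < K)
    -- the law of the state variable, and independent samples from it
    (μ : Measure (EuclideanSpace ℝ (Fin D))) [IsProbabilityMeasure μ]
    (X : Fin L → Ω → EuclideanSpace ℝ (Fin D))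
    (hX : ∀ l, HasLaw (X l) μ P) (hindep : iIndepFun X P)
    -- the function to be estimated, and the basis functions
    (y : EuclideanSpace ℝ (Fin D) → ℝ) (hy : Measurable y)
    (η : Fin K → EuclideanSpace ℝ (Fin D) → ℝ) (hη : ∀ k, Measurable (η k))
    (hbdd : ∀ k, ∃ C : ℝ, ∀ x, |η k x| ≤ C)
    -- bounds on the extremal eigenvalues of the Gram matrix
    (lamLow lamUp : ℝ) (hlamLow : 0 < lamLow)
    (hmin : lamLow ≤ minEigenvalue (gramMatrix μ η))
    (hmax : maxEigenvalue (gramMatrix μ η) ≤ lamUp)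
    (m : ℝ) (hm : m = ⨆ x : μ.support, ∑ k, |η k x| ^ 2)
    (ε : ℝ) (hε : ε ∈ Set.Ioo (0 : ℝ) 1) (τ : ℝ) (hτ : τ = (1 - ε) * lamLow)
    -- the coefficient vector that the algorithm computes from the samples
    (α : Ω → Fin K → ℝ)
    (hα : ∀ ω, IsBruteForceSVDCoeff hK τ (regressionMatrix η fun l => X l ω)
      (fun l => y (X l ω)) (α ω)) :
    AEMeasurable (fun ω => sqError μ η y (α ω)) P ∧
      ∫⁻ ω, sqError μ η y (α ω) ∂P ≤
        ENNReal.ofReal (1 + lamUp / (lamLow * (1 - ε))) * (⨅ a : Fin K → ℝ, sqError μ η y a) +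
          ENNReal.ofReal (2 * K * Real.exp (-(3 * ε ^ 2 * L /
            (6 * m * lamUp / lamLow ^ 2 + 2 * ε * (m / lamLow + lamUp / lamLow))))) *
          ∫⁻ x, ENNReal.ofReal (|y x| ^ 2) ∂μ := by
  have hη2 : ∀ k, MemLp (η k) 2 μ := memLp_of_measurable_of_bounded hη hbdd
  have hR := posSemidef_gramMatrix_sub hmin
  have hquad : ∀ v : Fin K → ℝ, lamLow * (v ⬝ᵥ v) ≤ ∫ x, (v ⬝ᵥ fun k => η k x) ^ 2 ∂μ := fun v =>
    (mul_dotProduct_self_le_quadForm hR v).trans_eq (quadForm_gramMatrix hη2 v)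
  have hξ : Measurable fun x k => η k x := measurable_pi_lambda _ hη
  have hae : ∀ᵐ x ∂μ, (fun k => η k x) ⬝ᵥ (fun k => η k x) ≤ m :=
    hm ▸ ae_sum_sq_le_iSup_support hbdd
  -- Testing the Gram matrix against a unit vector gives `lamLow ≤ lamUp` and `0 < m`.
  set e : Fin K → ℝ := Pi.single ⟨0, hK⟩ 1 with he
  have hee : e ⬝ᵥ e = 1 := by simp [he]
  have hlam : lamLow ≤ lamUp := by
    have := (mul_dotProduct_self_le_quadForm hR e).trans (quadForm_gramMatrix_le hmax e)
    rwa [hee, mul_one, mul_one] at this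
  have hm0 : 0 < m := by
    have h1 := hquad e
    rw [hee, mul_one] at h1
    refine hlamLow.trans_le (h1.trans ?_)
    have h2 : ∀ᵐ x ∂μ, (e ⬝ᵥ fun k => η k x) ^ 2 ≤ m := by
      filter_upwards [hae] with x hx
      refine le_trans ?_ hx
      rw [he, single_one_dotProduct, sq]
      exact Finset.single_le_sum (f := fun k => η k x * η k x) (fun _ _ => mul_self_nonneg _)
        (Finset.mem_univ _)
    refine (integral_mono_of_nonneg (Filter.Eventually.of_forall fun x => sq_nonneg _)
      (integrable_const m) h2).trans_eq ?_
    simp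
  have hτ0 : 0 < τ := hτ ▸ mul_pos (sub_pos.2 hε.2) hlamLow
  have hXm : AEMeasurable (fun ω l => X l ω) P := aemeasurable_pi_lambda _ fun l => (hX l).aemeasurable
  have hmap : P.map (fun ω l => X l ω) = Measure.pi fun _ => μ := by
    rw [(iIndepFun_iff_map_fun_eq_pi_map fun l => (hX l).aemeasurable).1 hindep]
    exact congrArg Measure.pi (funext fun l => (hX l).map_eq)
  rcases Nat.eq_zero_or_pos L with rfl | hL
  · -- Without samples, the estimator is zero and the exponential is at least one.
    have hα0 : ∀ ω, α ω = 0 := fun ω => by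
      obtain ⟨U, s, V, hsvd, h1, -⟩ := hα ω
      rw [h1 (by rw [Nat.cast_zero, zero_mul]; exact sq_nonneg _)]
      ext k
      simp [Matrix.mulVec, dotProduct]
    simp_rw [hα0]
    refine ⟨measurable_const.aemeasurable, ?_⟩
    rw [lintegral_const, measure_univ, mul_one]
    refine le_trans ?_ le_add_self
    have h1 : (1 : ℝ≥0∞) ≤ ENNReal.ofReal (2 * K * Real.exp (-(3 * ε ^ 2 * (0 : ℕ) /
        (6 * m * lamUp / lamLow ^ 2 + 2 * ε * (m / lamLow + lamUp / lamLow))))) := by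
      have : (1 : ℝ) ≤ K := Nat.one_le_cast.2 hK
      rw [ENNReal.one_le_ofReal]
      simp
      linarith
    refine le_trans (le_of_eq ?_) (mul_le_mul_left h1 _)
    simp [sqError]
  have hLτ : 0 < (L : ℝ) * τ := mul_pos (Nat.cast_pos.2 hL) hτ0
  have hα' : ∀ ω, α ω = sampleCoeff η y (L * τ) fun l => X l ω := fun ω =>
    (hα ω).eq_truncatedLeastSquares hLτ
  have hmeas : Measurable fun x : Fin L → EuclideanSpace ℝ (Fin D) =>
      sqError μ η y (sampleCoeff η y (L * τ) x) :=
    (measurable_sqError hy hη).comp (measurable_sampleCoeff hy hη _)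
  simp_rw [hα']
  refine ⟨hmeas.comp_aemeasurable hXm, ?_⟩
  by_cases hy2 : ∫⁻ x, ENNReal.ofReal (|y x| ^ 2) ∂μ = ∞
  · -- If `y` is not square integrable, the right-hand side is infinite.
    rw [hy2, ENNReal.mul_top, add_top]
    · exact le_top
    · have : (0 : ℝ) < K := Nat.cast_pos.2 hK
      exact (ENNReal.ofReal_pos.2 (by positivity)).ne'
  rw [← lintegral_map' (f := fun x => sqError μ η y (sampleCoeff η y (L * τ) x))
    hmeas.aemeasurable hXm, hmap]
  refine (lintegral_sqError_sampleCoeff_le hy hη hη2 (memLp_two_of_lintegral_ne_top hy hy2)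
    (isUnit_det_of_posSemidef_sub hlamLow hR) hmax (hlamLow.le.trans hlam) hτ0 hL).trans ?_
  refine add_le_add (le_of_eq (by rw [hτ, mul_comm lamLow])) (mul_le_mul_left ?_ _)
  simp_rw [regressionMatrix_transpose_mul_self, hτ]
  refine (measure_not_posSemidef_sum_le hξ hae hm0 hquad hε.1 (hε.2.le.trans one_le_two) L).trans
    (ENNReal.ofReal_le_ofReal ?_)
  rw [Fintype.card_fin]
  exact mul_exp_neg_le (Nat.cast_nonneg K) (Nat.cast_nonneg L) hm0 hlamLow hlam hε.1
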